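/- **Setting.** Let $X$ be a binary game with $N$ players, that is, a real payoff table $X^{(i)}=(X^{(i)}_{s})_{s\in\{1,2\}^N}$ for each player $i$. Let $K$ be $\mathbb{R}$ or $\mathbb{C}$, and let $p_s$, $s\in\{1,2\}^N$, be the homogeneous coordinates of $\mathbb{P}_K^{2^N-1}$. The *Spohn variety* $\mathcal V_X$ is the set of points $p$ with $\det M_i(p)=0$ for every player $i$, where $M_i(p)$ is the $2\times 2$ matrix with rows $\left(\sum_{s_i=k}p_s,\ \sum_{s_i=k}X^{(i)}_s p_s\right)$, $k=1,2$. For a graph on the set of players, let $\mathcal M$ be the set of points that satisfy the quadratic equations $p_{i_Ai_Bi_C+}\,p_{j_Aj_Bi_C+}-p_{i_Aj_Bi_C+}\,p_{j_Ai_Bi_C+}=0$ of all conditional independence statements $A\perp B\mid C$ with $A,B,C$ disjoint and $A,B$ separated by $C$ in the graph (here $+$ denotes summation over the strategies of the remaining players). The *Spohn CI variety* is the Zariski closure of $(\mathcal V_X\cap\mathcal M)\setminus\mathcal W$, where $\mathcal W$ is the union of the hyperplanes $\{p_s=0\}$, $s\in\{1,2\}^N$, and $\{\sum_s p_s=0\}$.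 Let $2l\le N$. The *Nash CI variety* $Y_{X,l}$ is the Spohn CI variety of the graph in which the last $2l$ players are joined by an edge in pairs $(1,1),(1,2);\ \dots;\ (l,1),(l,2)$ and the first $N-2l$ players are isolated. For this graph $\mathcal M$ is the Segre variety $(\mathbb{P}^1)^{N-2l}\times(\mathbb{P}^3)^l$, parametrized by $$p_{s}=\prod_{i=1}^{N-2l}\sigma^{(i)}_{s_i}\ \prod_{i=1}^{l}\sigma^{(N-2l+i)}_{s_{(i,1)}s_{(i,2)}} .$$ The affine open part $U_{X,l}\subseteq Y_{X,l}$ is the subset where $\sigma^{(i)}_2\ne0$ for $1\le i\le N-2l$ and $\sigma^{(i)}_{22}\neq 0$ for $N-2l<i\le N-l$. Since $p_{2\cdots2}\neq0$ on $U_{X,l}$, we regard $U_{X,l}$ as a subset of affine space with coordinates $p_s/p_{2\cdots 2}$. **Theorem.** Let $l,m,n\ge 0$ be integers with $m\le n-l$, let $G_1,\dots,G_m\in\mathbb{R}[x_1,\dots,x_n]$, and let $S=\{x\in\mathbb{R}^n : G_1(x)=\cdots=G_m(x)=0\}$ be the real affine algebraic variety that they define. For $i\in\{1,\dots,n\}$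 let $\delta_i$ be the maximum of the degrees of $x_i$ in $G_1,\dots,G_m$ (with the degree of the zero polynomial, and the maximum for $m=0$, taken to be $0$), and let $\delta=\delta_1+\cdots+\delta_n$. Then there is a $(\delta+n+l)$-player binary game $X$ such that $U_{X,l}$ is isomorphic to $S$ as a real algebraic variety: there are polynomial maps with real coefficients that restrict to mutually inverse bijections between $S$ and $U_{X,l}$ over $K=\mathbb{R}$, and these same maps restrict to mutually inverse bijections between the complex zero set of $G_1,\dots,G_m$ and $U_{X,l}$ over $K=\mathbb{C}$. -/

import Mathlib

namespace NashCI

/-- Pure strategy profiles of a binary game with set of players `ι`.  The two strategies, usually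
called `1` and `2`, are `0` and `1` in `Fin 2`. -/
abbrev Profile (ι : Type*) := ι → Fin 2

/-- A binary game with set of players `ι`: a real payoff table for each player. -/
abbrev Game (ι : Type*) := ι → Profile ι → ℝ

/-- The projective space over `K` whose homogeneous coordinates `p_s` are indexed by the pure
strategy profiles. -/
abbrev ProfileSpace (K ι : Type*) [Field K] := Projectivization K (Profile ι → K)

section General

variable {K ι : Type*} [Field K] [Algebra ℝ K] [Fintype ι] [DecidableEq ι]

/-- The matrix `M_i`: the row of strategy `k` of player `i` is
`(p_{+⋯k⋯+}, ∑_{s, s_i = k} X^{(i)}_s p_s)`. -/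
def spohnMatrix (X : Game ι) (p : Profile ι → K) (i : ι) : Matrix (Fin 2) (Fin 2) K :=
  Matrix.of fun k =>
    ![∑ s : Profile ι with s i = k, p s,
      ∑ s : Profile ι with s i = k, algebraMap ℝ K (X i s) * p s]

/-- The Spohn variety of `X`, cut out by the determinants of the matrices `M_i`.  (This condition,
and the others below that mention `P.rep`, are homogeneous in the coordinates.) -/
def spohnVariety (K : Type*) [Field K] [Algebra ℝ K] (X : Game ι) : Set (ProfileSpace K ι) :=
  {P | ∀ i, (spohnMatrix X P.rep i).det = 0}

/-- The marginal `p_{s_A +}`: the sum of `p_t` over all profiles `t` that agree with `s` on `A`. -/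
def marginal (p : Profile ι → K) (A : Finset ι) (s : Profile ι) : K :=
  ∑ t : Profile ι with ∀ i ∈ A, t i = s i, p t

/-- The quadratic equations of the conditional independence statement `A ⫫ B | C`:
`p_{i_A i_B i_C +} p_{j_A j_B i_C +} - p_{i_A j_B i_C +} p_{j_A i_B i_C +} = 0`, where `s` is a
profile that extends `(i_A, i_B, i_C)` and `t` one that extends `(j_A, j_B, i_C)`. -/
def CondIndep (p : Profile ι → K) (A B C : Finset ι) : Prop :=
  ∀ s t : Profile ι, (∀ c ∈ C, s c = t c) →
    marginal p (A ∪ B ∪ C) s * marginal p (A ∪ B ∪ C) t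
      - marginal p (A ∪ B ∪ C) (B.piecewise t s) * marginal p (A ∪ B ∪ C) (A.piecewise t s) = 0

/-- `C` separates `A` and `B` in the graph `G`: every path from a vertex of `A` to a vertex of `B`
meets `C`. -/
def Separates (G : SimpleGraph ι) (A B C : Finset ι) : Prop :=
  ∀ a ∈ A, ∀ b ∈ B, ∀ q : G.Walk a b, q.IsPath → ∃ c ∈ C, c ∈ q.support

/-- The discrete conditional independence model of the global Markov property of `G`. -/
def independenceModel (K : Type*) [Field K] (G : SimpleGraph ι) : Set (ProfileSpace K ι) :=
  {P | ∀ A B C : Finset ι, Disjoint A B → Disjoint A C → Disjoint B C → Separates G A B C →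
    CondIndep P.rep A B C}

/-- The union of the hyperplanes `p_s = 0`, for all profiles `s`, and `p_{+⋯+} = 0`. -/
def specialHyperplanes (K ι : Type*) [Field K] [Fintype ι] [DecidableEq ι] :
    Set (ProfileSpace K ι) :=
  {P | (∃ s, P.rep s = 0) ∨ ∑ s, P.rep s = 0}

/-- The Zariski closure of a subset of a projective space over `K`. -/
def zariskiClosure {τ : Type*} (T : Set (Projectivization K (τ → K))) :
    Set (Projectivization K (τ → K)) :=
  {P | ∀ (H : MvPolynomial τ K) (d : ℕ), H.IsHomogeneous d →
    (∀ Q ∈ T, MvPolynomial.eval Q.rep H = 0) → MvPolynomial.eval P.rep H = 0}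

/-- The Spohn conditional independence variety of the game `X` and the graph `G`. -/
def spohnCIVariety (K : Type*) [Field K] [Algebra ℝ K] (X : Game ι) (G : SimpleGraph ι) :
    Set (ProfileSpace K ι) :=
  zariskiClosure ((spohnVariety K X ∩ independenceModel K G) \ specialHyperplanes K ι)

variable {κ : Type*}

/-- The disjoint union of the complete graphs on the groups of a partition of the players; the
partition is given by the map `c` that sends a player to the label of its group. -/
def cliqueGraph (c : ι → κ) : SimpleGraph ι where
  Adj i j := i ≠ j ∧ c i = c j
  symm := ⟨fun _ _ h => ⟨h.1.symm, h.2.symm⟩⟩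
  loopless := ⟨fun _ h => h.1 rfl⟩

/-- The Nash conditional independence variety of the game `X` and the partition `c`. -/
def nashCIVariety (K : Type*) [Field K] [Algebra ℝ K] (X : Game ι) (c : ι → κ) :
    Set (ProfileSpace K ι) :=
  spohnCIVariety K X (cliqueGraph c)

/-- The Segre parametrization `p_s = ∏_r σ^{(r)}_{s_r}`, where `r` runs through the groups and
`s_r` is the restriction of the profile `s` to the group `r`. -/
def segre [Fintype κ] (c : ι → κ) (σ : (r : κ) → Profile {i // c i = r} → K) : Profile ι → K :=
  fun s => ∏ r, σ r fun i => s i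

/-- The open subset of the Nash conditional independence variety that is defined by
`σ^{(r)}_{2⋯2} ≠ 0` for all groups `r`. -/
def nashCIOpen (K : Type*) [Field K] [Algebra ℝ K] [Fintype κ] (X : Game ι) (c : ι → κ) :
    Set (ProfileSpace K ι) :=
  {P | P ∈ nashCIVariety K X c ∧
    ∃ (σ : (r : κ) → Profile {i // c i = r} → K) (hσ : segre c σ ≠ 0),
      P = Projectivization.mk K (segre c σ) hσ ∧ ∀ r, σ r (fun _ => 1) ≠ 0}

/-- The part of a subset `T` of projective space in the standard affine chart `p_{2⋯2} = 1`,
as a subset of affine space. -/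
def inChart (T : Set (ProfileSpace K ι)) : Set (Profile ι → K) :=
  {u | u (fun _ => 1) = 1 ∧ ∃ hu : u ≠ 0, Projectivization.mk K u hu ∈ T}

end General

/-- `k` players on their own, followed by `l` pairs of players `(i,1), (i,2)`. -/
abbrev Player (k l : ℕ) := Fin k ⊕ Fin l × Fin 2

/-- The partition of the players of type `(1,…,1,2,…,2)`, with `k` ones and `l` twos. -/
def pairing (k l : ℕ) : Player k l → Fin k ⊕ Fin l :=
  Sum.map id Prod.fst

/-- The variety `Y_{X,l}`. -/
def varietyY (K : Type*) [Field K] [Algebra ℝ K] {k l : ℕ} (X : Game (Player k l)) :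
    Set (ProfileSpace K (Player k l)) :=
  nashCIVariety K X (pairing k l)

/-- The affine open subset `U_{X,l}` of `Y_{X,l}`, defined by `σ^{(i)}_2 ≠ 0` for the `k` factors
`ℙ¹` and `σ^{(i)}_{22} ≠ 0` for the `l` factors `ℙ³`. -/
def openU (K : Type*) [Field K] [Algebra ℝ K] {k l : ℕ} (X : Game (Player k l)) :
    Set (ProfileSpace K (Player k l)) :=
  nashCIOpen K X (pairing k l)

/-- The points with coordinates in `K` of the affine variety defined by the real polynomials
`G_j`. -/
def zeroSet (K : Type*) [Field K] [Algebra ℝ K] {n m : ℕ}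
    (G : Fin m → MvPolynomial (Fin n) ℝ) : Set (Fin n → K) :=
  {x | ∀ j, MvPolynomial.aeval x (G j) = 0}

/-- The map of affine spaces over `K` given by real polynomials. -/
noncomputable def polyMap (K : Type*) [Field K] [Algebra ℝ K] {τ υ : Type*}
    (f : υ → MvPolynomial τ ℝ) (x : τ → K) : υ → K :=
  fun j => MvPolynomial.aeval x (f j)

/-- The polynomial maps `f` and `g`, with real coefficients, restrict to mutually inverse
bijections between the sets `A` and `B` of points over `K`. -/
def InversePolyMaps {K : Type*} [Field K] [Algebra ℝ K] {τ υ : Type*}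
    (f : υ → MvPolynomial τ ℝ) (g : τ → MvPolynomial υ ℝ)
    (A : Set (τ → K)) (B : Set (υ → K)) : Prop :=
  Set.MapsTo (polyMap K f) A B ∧ Set.MapsTo (polyMap K g) B A ∧
    Set.InvOn (polyMap K g) (polyMap K f) A B

end NashCI

namespace NashCI

set_option linter.unusedSectionVars false

open MvPolynomial in
lemma eval_smul_of_isHomogeneous {R τ : Type*} [CommSemiring R] {H : MvPolynomial τ R} {d : ℕ}
    (hH : H.IsHomogeneous d) (a : R) (v : τ → R) : eval (a • v) H = a ^ d * eval v H := by
  rw [eval_eq, eval_eq, Finset.mul_sum]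
  refine Finset.sum_congr rfl fun e he => ?_
  have h : e.degree = d := by
    have h := hH (mem_support_iff.mp he)
    rwa [Finsupp.degree_eq_weight_one]
  simp only [Pi.smul_apply, smul_eq_mul, mul_pow, Finset.prod_mul_distrib]
  rw [Finset.prod_pow_eq_pow_sum, ← h, Finsupp.degree_apply]
  ring

section General

variable {K ι κ : Type*} [Field K] [Fintype ι] [DecidableEq ι]

lemma exists_rep_eq_smul {τ : Type*} (u : τ → K) (hu : u ≠ 0) :
    ∃ a : K, a ≠ 0 ∧ (Projectivization.mk K u hu).rep = a • u := by
  obtain ⟨a, ha⟩ := Projectivization.exists_smul_eq_mk_rep K u hu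
  exact ⟨a, a.ne_zero, ha.symm⟩

lemma mem_zariskiClosure_mk {τ : Type*} {T : Set (Projectivization K (τ → K))} (u : τ → K)
    (hu : u ≠ 0) : Projectivization.mk K u hu ∈ zariskiClosure T ↔
      ∀ (H : MvPolynomial τ K) (d : ℕ), H.IsHomogeneous d →
        (∀ Q ∈ T, MvPolynomial.eval Q.rep H = 0) → MvPolynomial.eval u H = 0 := by
  obtain ⟨a, ha, h⟩ := exists_rep_eq_smul u hu
  refine forall₂_congr fun H d => forall₂_congr fun hH _ => ?_
  rw [h, eval_smul_of_isHomogeneous hH]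
  simp [ha]

/-- A linear form that vanishes on a set vanishes on its Zariski closure. -/
lemma linear_eq_zero_of_mem_zariskiClosure {τ : Type*} [Fintype τ]
    {T : Set (Projectivization K (τ → K))} {u : τ → K} {hu : u ≠ 0}
    (h : Projectivization.mk K u hu ∈ zariskiClosure T) (w : τ → K)
    (hw : ∀ Q ∈ T, ∑ s, w s * Q.rep s = 0) : ∑ s, w s * u s = 0 := by
  have := (mem_zariskiClosure_mk u hu).mp h (∑ s, MvPolynomial.C (w s) * MvPolynomial.X s) 1
    (MvPolynomial.IsHomogeneous.sum _ _ _ fun s _ => by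
      simpa using (MvPolynomial.isHomogeneous_C τ (w s)).mul (MvPolynomial.isHomogeneous_X K s))
  simpa using this (by simpa using hw)

lemma marginal_smul (a : K) (p : Profile ι → K) (A : Finset ι) (s : Profile ι) :
    marginal (a • p) A s = a * marginal p A s := by
  simp [marginal, Finset.mul_sum]

lemma CondIndep.smul {p : Profile ι → K} {A B C : Finset ι} (h : CondIndep p A B C) (a : K) :
    CondIndep (a • p) A B C := by
  intro s t hst
  simp only [marginal_smul]
  linear_combination a ^ 2 * h s t hst

lemma det_spohnMatrix [Algebra ℝ K] (X : Game ι) (p : Profile ι → K) (i : ι) :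
    (spohnMatrix X p i).det =
      (∑ s : Profile ι with s i = 0, p s) *
          (∑ s : Profile ι with s i = 1, algebraMap ℝ K (X i s) * p s) -
        (∑ s : Profile ι with s i = 0, algebraMap ℝ K (X i s) * p s) *
          (∑ s : Profile ι with s i = 1, p s) := by
  simp [spohnMatrix, Matrix.det_fin_two]

lemma det_spohnMatrix_of_eq_zero [Algebra ℝ K] {X : Game ι} {i : ι} (hX : ∀ s : Profile ι, s i = 0 → X i s = 0)
    (p : Profile ι → K) :
    (spohnMatrix X p i).det =
      (∑ s : Profile ι with s i = 0, p s) *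
          (∑ s : Profile ι with s i = 1, algebraMap ℝ K (X i s) * p s) := by
  rw [det_spohnMatrix, Finset.sum_eq_zero (s := {s : Profile ι | s i = 0})
    (f := fun s => algebraMap ℝ K (X i s) * p s), zero_mul, sub_zero]
  intro s hs
  rw [hX s (by simpa using hs), map_zero, zero_mul]

lemma det_spohnMatrix_smul [Algebra ℝ K] (X : Game ι) (a : K) (p : Profile ι → K) (i : ι) :
    (spohnMatrix X (a • p) i).det = a ^ 2 * (spohnMatrix X p i).det := by
  simp only [det_spohnMatrix, Pi.smul_apply, smul_eq_mul, mul_left_comm _ a, ← Finset.mul_sum]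
  ring

/-- The players of the group `r`. -/
def group [DecidableEq κ] (c : ι → κ) (r : κ) : Finset ι := {i | c i = r}

lemma mem_group [DecidableEq κ] {c : ι → κ} {r : κ} {i : ι} : i ∈ group c r ↔ c i = r := by
  simp [group]

lemma marginal_univ (p : Profile ι → K) (s : Profile ι) : marginal p Finset.univ s = p s := by
  have : (Finset.univ.filter fun t : Profile ι => ∀ i ∈ Finset.univ, t i = s i) = {s} := by
    ext t; simp [funext_iff]
  rw [marginal, this, Finset.sum_singleton]

lemma eq_of_walk_cliqueGraph {c : ι → κ} {a b : ι} (q : (cliqueGraph c).Walk a b) : c a = c b := by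
  induction q with
  | nil => rfl
  | cons h _ ih => exact h.2.trans ih

/-- The members of a group are independent of the other players. -/
lemma mul_eq_of_mem_independenceModel [DecidableEq κ] {c : ι → κ} {P : ProfileSpace K ι}
    (hP : P ∈ independenceModel K (cliqueGraph c)) (r : κ) (s t : Profile ι) :
    P.rep s * P.rep t =
      P.rep ((group c r)ᶜ.piecewise t s) * P.rep ((group c r).piecewise t s) := by
  have h := hP (group c r) (group c r)ᶜ ∅ disjoint_compl_right (by simp) (by simp)
    (fun a ha b hb q _ => absurd (eq_of_walk_cliqueGraph q) (by
      rw [Finset.mem_compl, mem_group] at hb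
      rw [mem_group.mp ha]; exact fun h => hb h.symm)) s t (by simp)
  simp only [Finset.union_compl, Finset.union_empty, marginal_univ] at h
  exact sub_eq_zero.mp h

lemma mul_sum_eq_marginal_mul_marginal [DecidableEq κ] {c : ι → κ} {P : ProfileSpace K ι}
    (hP : P ∈ independenceModel K (cliqueGraph c)) (r : κ) (s : Profile ι) :
    P.rep s * ∑ t, P.rep t =
      marginal P.rep (group c r) s * marginal P.rep (group c r)ᶜ s := by
  rw [Finset.mul_sum, marginal, marginal, Finset.sum_mul_sum, ← Finset.sum_product']
  refine Finset.sum_nbij' (fun t => ((group c r)ᶜ.piecewise t s, (group c r).piecewise t s))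
    (fun v => (group c r).piecewise v.2 v.1) ?_ ?_ ?_ ?_ ?_
  · intro t _
    simp +contextual [Finset.piecewise]
  · simp
  · intro t _
    ext i
    by_cases hi : i ∈ group c r <;> simp [Finset.piecewise, hi]
  · intro v hv
    simp only [Finset.mem_product, Finset.mem_filter, Finset.mem_univ, true_and,
      Finset.mem_compl] at hv
    ext i
    · by_cases hi : i ∈ group c r
      · simp [Finset.piecewise, hi, hv.1 i hi]
      · simp [Finset.piecewise, hi]
    · by_cases hi : i ∈ group c r
      · simp [Finset.piecewise, hi]
      · simp [Finset.piecewise, hi, hv.2 i hi]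
  · intro t _
    exact mul_eq_of_mem_independenceModel hP r s t

lemma marginal_ne_zero [DecidableEq κ] {c : ι → κ} {P : ProfileSpace K ι}
    (hP : P ∈ independenceModel K (cliqueGraph c)) (hW : P ∉ specialHyperplanes K ι) (r : κ)
    (s : Profile ι) : marginal P.rep (group c r) s ≠ 0 := by
  simp only [specialHyperplanes, Set.mem_ofPred_eq, not_or, not_exists] at hW
  have h := mul_ne_zero (hW.1 s) hW.2
  rw [mul_sum_eq_marginal_mul_marginal hP r] at h
  exact left_ne_zero_of_mul h

/-- If `i`, `i'` are a group of two players and the marginal `p_{+⋯0⋯+}` of player `i` vanishes,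
then the sum of two coordinates that differ at `i'` only, with player `i` playing `0`, is zero. -/
lemma add_eq_zero_of_marginal_eq_zero [DecidableEq κ] {c : ι → κ} {P : ProfileSpace K ι}
    (hP : P ∈ independenceModel K (cliqueGraph c)) (hW : P ∉ specialHyperplanes K ι) {r : κ}
    {i i' : ι} (hg : group c r = {i, i'}) (hne : i ≠ i')
    (h0 : ∑ s : Profile ι with s i = 0, P.rep s = 0) (s : Profile ι) (hs : s i = 0) :
    P.rep s + P.rep (Function.update s i' (1 - s i')) = 0 := by
  simp only [specialHyperplanes, Set.mem_ofPred_eq, not_or, not_exists] at hW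
  have h1 := mul_sum_eq_marginal_mul_marginal hP r s
  have h2 := mul_sum_eq_marginal_mul_marginal hP r (Function.update s i' (1 - s i'))
  have h3 : marginal P.rep (group c r)ᶜ (Function.update s i' (1 - s i')) =
      marginal P.rep (group c r)ᶜ s := by
    unfold marginal
    congr 1
    ext t
    simp only [hg, Finset.mem_filter, Finset.mem_univ, true_and]
    refine forall₂_congr fun j hj => ?_
    rw [Function.update_of_ne]
    rintro rfl
    simp at hj
  have h4 : marginal P.rep (group c r) s +
      marginal P.rep (group c r) (Function.update s i' (1 - s i')) = 0 := by
    rw [← h0, ← Finset.sum_filter_add_sum_filter_not _ (fun t => t i' = s i'), Finset.filter_filter,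
      Finset.filter_filter]
    unfold marginal
    congr 2
    · ext t
      simp [hg, hs]
    · ext t
      simp only [hg, Finset.mem_filter, Finset.mem_univ, true_and, Finset.mem_insert,
        Finset.mem_singleton, forall_eq_or_imp, forall_eq, Function.update_self,
        Function.update_of_ne hne, hs]
      have : ∀ a b : Fin 2, a = 1 - b ↔ ¬ a = b := by decide
      rw [this]
  rw [h3] at h2
  refine (mul_eq_zero.mp ?_).resolve_right hW.2
  rw [add_mul, h1, h2, ← add_mul, h4, zero_mul]

/-- Points of the Segre variety satisfy the conditional independence statements. -/
lemma condIndep_segre [Fintype κ] (c : ι → κ)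
    (σ : (r : κ) → Profile {i // c i = r} → K) {A B C : Finset ι}
    (hAB : Disjoint A B) (hAC : Disjoint A C) (hBC : Disjoint B C)
    (hsep : Separates (cliqueGraph c) A B C) : CondIndep (segre c σ) A B C := by
  classical
  have hgroup : ∀ a ∈ A, ∀ b ∈ B, c a ≠ c b := by
    intro a ha b hb hab
    have hne : a ≠ b := fun h => Finset.disjoint_left.mp hAB ha (h ▸ hb)
    have hadj : (cliqueGraph c).Adj a b := ⟨hne, hab⟩
    obtain ⟨x, hx, hx'⟩ := hsep a ha b hb (SimpleGraph.Walk.cons hadj SimpleGraph.Walk.nil)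
      (by simp [SimpleGraph.Walk.cons_isPath_iff, hne])
    simp only [SimpleGraph.Walk.support_cons, SimpleGraph.Walk.support_nil, List.mem_cons,
      List.not_mem_nil, or_false] at hx'
    rcases hx' with rfl | rfl
    · exact Finset.disjoint_left.mp hAC ha hx
    · exact Finset.disjoint_left.mp hBC hb hx
  intro s t hst
  let R : Finset κ := B.image c
  let sw : Profile ι → Profile ι → Profile ι := fun u v i => if c i ∈ R then v i else u i
  have hsw : ∀ u v, segre c σ u * segre c σ v = segre c σ (sw u v) * segre c σ (sw v u) := by
    intro u v
    simp only [segre, ← Finset.prod_mul_distrib]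
    refine Finset.prod_congr rfl fun r _ => ?_
    by_cases hr : r ∈ R
    · have e1 : (fun i : {i // c i = r} => sw u v i) = fun i => v i.1 := by
        ext i; simp [sw, i.2, hr]
      have e2 : (fun i : {i // c i = r} => sw v u i) = fun i => u i.1 := by
        ext i; simp [sw, i.2, hr]
      rw [e1, e2, mul_comm]
    · have e1 : (fun i : {i // c i = r} => sw u v i) = fun i => u i.1 := by
        ext i; simp [sw, i.2, hr]
      have e2 : (fun i : {i // c i = r} => sw v u i) = fun i => v i.1 := by
        ext i; simp [sw, i.2, hr]
      rw [e1, e2]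
  have hswsw : ∀ u v, sw (sw u v) (sw v u) = u := by
    intro u v; ext i; simp only [sw]; split_ifs <;> rfl
  have hB : ∀ i ∈ B, c i ∈ R := fun i hi => Finset.mem_image_of_mem c hi
  have hA : ∀ i ∈ A, c i ∉ R := by
    intro i hi h
    obtain ⟨b, hb, hbi⟩ := Finset.mem_image.mp h
    exact hgroup i hi b hb hbi.symm
  have key : ∀ u v : Profile ι,
      ((∀ i ∈ A ∪ B ∪ C, u i = s i) ∧ (∀ i ∈ A ∪ B ∪ C, v i = t i)) →
      ((∀ i ∈ A ∪ B ∪ C, sw u v i = B.piecewise t s i) ∧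
        (∀ i ∈ A ∪ B ∪ C, sw v u i = A.piecewise t s i)) := by
    rintro u v ⟨hu, hv⟩
    have aux : ∀ i ∈ A ∪ B ∪ C, sw u v i = B.piecewise t s i ∧ sw v u i = A.piecewise t s i := by
      intro i hi
      have hui := hu i hi
      have hvi := hv i hi
      simp only [Finset.mem_union] at hi
      rcases hi with (hi | hi) | hi
      · have := Finset.disjoint_left.mp hAB hi
        simp [sw, hA i hi, this, hi, hui, hvi]
      · have := Finset.disjoint_right.mp hAB hi
        simp [sw, hB i hi, this, hi, hui, hvi]
      · have h1 := Finset.disjoint_right.mp hAC hi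
        have h2 := Finset.disjoint_right.mp hBC hi
        simp only [sw, Finset.piecewise_eq_of_notMem _ _ _ h1,
          Finset.piecewise_eq_of_notMem _ _ _ h2, hui, hvi, hst i hi, ite_self, and_self]
    exact ⟨fun i hi => (aux i hi).1, fun i hi => (aux i hi).2⟩
  have key' : ∀ u v : Profile ι,
      ((∀ i ∈ A ∪ B ∪ C, u i = B.piecewise t s i) ∧ (∀ i ∈ A ∪ B ∪ C, v i = A.piecewise t s i)) →
      ((∀ i ∈ A ∪ B ∪ C, sw u v i = s i) ∧ (∀ i ∈ A ∪ B ∪ C, sw v u i = t i)) := by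
    rintro u v ⟨hu, hv⟩
    have aux : ∀ i ∈ A ∪ B ∪ C, sw u v i = s i ∧ sw v u i = t i := by
      intro i hi
      have hui := hu i hi
      have hvi := hv i hi
      simp only [Finset.mem_union] at hi
      rcases hi with (hi | hi) | hi
      · have := Finset.disjoint_left.mp hAB hi
        simp_all [sw]
      · have := Finset.disjoint_right.mp hAB hi
        simp_all [sw]
      · have h1 := Finset.disjoint_right.mp hAC hi
        have h2 := Finset.disjoint_right.mp hBC hi
        rw [Finset.piecewise_eq_of_notMem _ _ _ h2] at hui
        rw [Finset.piecewise_eq_of_notMem _ _ _ h1] at hvi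
        simp only [sw, hui, hvi, hst i hi, ite_self, and_self]
    exact ⟨fun i hi => (aux i hi).1, fun i hi => (aux i hi).2⟩
  rw [sub_eq_zero]
  simp only [marginal, Finset.sum_mul_sum, ← Finset.sum_product']
  refine Finset.sum_nbij' (fun v => (sw v.1 v.2, sw v.2 v.1)) (fun v => (sw v.1 v.2, sw v.2 v.1))
    ?_ ?_ ?_ ?_ ?_
  · rintro ⟨u, v⟩ h
    simp only [Finset.mem_product, Finset.mem_filter, Finset.mem_univ, true_and] at h ⊢
    exact key u v h
  · rintro ⟨u, v⟩ h
    simp only [Finset.mem_product, Finset.mem_filter, Finset.mem_univ, true_and] at h ⊢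
    exact key' u v h
  · rintro ⟨u, v⟩ _; simp [hswsw]
  · rintro ⟨u, v⟩ _; simp [hswsw]
  · rintro ⟨u, v⟩ _; exact hsw u v

/-- The extension of a profile of the group `r` in which all other players play `1`. -/
def extend [DecidableEq κ] (c : ι → κ) (r : κ) (a : Profile {i // c i = r}) : Profile ι :=
  fun i => if h : c i = r then a ⟨i, h⟩ else 1

/-- The coordinates of the Segre variety are determined by the profiles that differ from `1` in a
single group. -/
lemma eq_segre_of_eq_smul_segre [Fintype κ] [DecidableEq κ] {c : ι → κ}
    {σ : (r : κ) → Profile {i // c i = r} → K} {u : Profile ι → K} {a : K}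
    (h1 : u (fun _ => 1) = 1) (hu : u = a • segre c σ) :
    u = segre c fun r b => u (extend c r b) := by
  have hσ : a * ∏ r, σ r (fun _ => 1) = 1 := by
    rw [hu] at h1; simpa [segre] using h1
  have hne : ∀ r, σ r (fun _ => 1) ≠ 0 := by
    intro r hr
    rw [Finset.prod_eq_zero (Finset.mem_univ r) hr, mul_zero] at hσ
    exact zero_ne_one hσ
  have hext : ∀ r b, u (extend c r b) = σ r b / σ r fun _ => 1 := by
    intro r b
    have e : segre c σ (extend c r b) = σ r b * ∏ r' ∈ Finset.univ.erase r, σ r' fun _ => 1 := by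
      rw [segre, ← Finset.mul_prod_erase _ _ (Finset.mem_univ r)]
      congr 1
      · congr 1; ext i; simp [extend, i.2]
      · refine Finset.prod_congr rfl fun r' hr' => ?_
        congr 1; ext i
        simp [extend, i.2, Finset.ne_of_mem_erase hr']
    rw [hu, eq_div_iff (hne r)]
    rw [← Finset.mul_prod_erase _ _ (Finset.mem_univ r)] at hσ
    simp only [Pi.smul_apply, smul_eq_mul, e]
    linear_combination σ r b * hσ
  ext s
  simp only [segre, hext, Finset.prod_div_distrib]
  rw [eq_div_iff (Finset.prod_ne_zero_iff.mpr fun r _ => hne r)]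
  conv_lhs => rw [hu]
  simp only [Pi.smul_apply, smul_eq_mul, segre]
  linear_combination (∏ r, σ r fun i => s i) * hσ

lemma sum_segre [Fintype κ] [DecidableEq κ] (c : ι → κ)
    (σ : (r : κ) → Profile {i // c i = r} → K) :
    ∑ s, segre c σ s = ∏ r, ∑ a, σ r a := by
  rw [Finset.prod_univ_sum, Fintype.piFinset_univ]
  let e : Profile ι ≃ ((r : κ) → Profile {i // c i = r}) :=
    { toFun := fun s r i => s i
      invFun := fun a i => a (c i) ⟨i, rfl⟩
      left_inv := fun s => rfl
      right_inv := fun a => by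
        ext r ⟨i, hi⟩
        subst hi
        rfl }
  exact Fintype.sum_equiv e _ _ fun s => rfl

end General

section Parametrization

variable {R ι κ : Type*} [CommRing R] [Fintype ι] [DecidableEq κ]

/-- The line in the space of tensors of the group `r` on which the coordinate of `1⋯1` is `1`, the
coordinate of `0⋯0` is the parameter, and all other coordinates are its negative. -/
def lineFactor (c : ι → κ) (z : κ → R) (r : κ) (a : Profile {i // c i = r}) : R :=
  if ∀ i, a i = 1 then 1 else if ∀ i, a i = 0 then z r else -z r

/-- The restriction of the Segre parametrization to a product of lines. -/
def lineSegre [Fintype κ] (c : ι → κ) (z : κ → R) : Profile ι → R :=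
  fun s => ∏ r, lineFactor c z r fun i => s i

lemma lineFactor_one (c : ι → κ) (z : κ → R) (r : κ) : lineFactor c z r (fun _ => 1) = 1 := by
  simp [lineFactor]

lemma lineFactor_zero {c : ι → κ} (hc : Function.Surjective c) (z : κ → R) (r : κ) :
    lineFactor c z r (fun _ => 0) = z r := by
  obtain ⟨i, hi⟩ := hc r
  rw [lineFactor, if_neg (fun h => absurd (h ⟨i, hi⟩) (by decide)), if_pos (fun _ => rfl)]

lemma lineSegre_one [Fintype κ] (c : ι → κ) (z : κ → R) : lineSegre c z (fun _ => 1) = 1 := by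
  simp [lineSegre, lineFactor_one]

/-- The profile in which the groups in `T` play `0` and all others play `1`. -/
def groupProfile (c : ι → κ) (T : Finset κ) : Profile ι := fun i => if c i ∈ T then 0 else 1

lemma lineSegre_groupProfile [Fintype κ] {c : ι → κ} (hc : Function.Surjective c) (z : κ → R)
    (T : Finset κ) : lineSegre c z (groupProfile c T) = ∏ r ∈ T, z r := by
  have h : ∀ r, lineFactor c z r (fun i => groupProfile c T i) = if r ∈ T then z r else 1 := by
    intro r
    split_ifs with hr
    · rw [← lineFactor_zero hc z r]
      congr 1; ext i; simp [groupProfile, i.2, hr]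
    · rw [← lineFactor_one c z r]
      congr 1; ext i; simp [groupProfile, i.2, hr]
  simp only [lineSegre, h]
  rw [Finset.prod_ite_mem, Finset.univ_inter]

lemma map_lineSegre [Fintype κ] {S F : Type*} [CommRing S] [FunLike F R S] [RingHomClass F R S]
    (φ : F) (c : ι → κ) (z : κ → R) (s : Profile ι) :
    φ (lineSegre c z s) = lineSegre c (fun r => φ (z r)) s := by
  simp only [lineSegre, map_prod, lineFactor, apply_ite φ, map_one, map_neg]

/-- Every multi-affine polynomial that does not involve the parameter of the group of player `i`
is a linear combination of coordinates whose profiles have player `i` playing `1`. -/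
lemma prod_sub_mem_span_lineSegre [Fintype κ] [Algebra ℝ R] {c : ι → κ}
    (hc : Function.Surjective c)
    (z : κ → R) (a : ℝ) (i : ι) {T : Finset κ} (hT : c i ∉ T) :
    ∏ r ∈ T, (z r - algebraMap ℝ R a) ∈
      Submodule.span ℝ (lineSegre c z '' {s | s i = 1}) := by
  rw [Finset.prod_sub]
  refine Submodule.sum_mem _ fun T' hT' => ?_
  have : (-1) ^ T'.card * (∏ r ∈ T \ T', z r) * ∏ _r ∈ T', algebraMap ℝ R a =
      ((-1) ^ T'.card * a ^ T'.card) • lineSegre c z (groupProfile c (T \ T')) := by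
    rw [lineSegre_groupProfile hc, Algebra.smul_def, Finset.prod_const]
    simp only [map_mul, map_pow, map_neg, map_one]
    ring
  rw [this]
  refine Submodule.smul_mem _ _ (Submodule.subset_span ⟨_, ?_, rfl⟩)
  have : c i ∉ T \ T' := fun h => hT (Finset.sdiff_subset h)
  simp [groupProfile, this]

end Parametrization

section Pairing

variable {K : Type*} [Field K] {k l : ℕ}

lemma pairing_surjective : Function.Surjective (pairing k l) := by
  rintro (q | j)
  · exact ⟨.inl q, rfl⟩
  · exact ⟨.inr (j, 0), rfl⟩

lemma group_pairing_inl (q : Fin k) : group (pairing k l) (.inl q) = {.inl q} := by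
  ext (i | ⟨j, b⟩) <;> simp [mem_group, pairing]

lemma group_pairing_inr (j : Fin l) (b : Fin 2) :
    group (pairing k l) (.inr j) = {.inr (j, b), .inr (j, 1 - b)} := by
  ext (i | ⟨j', b'⟩)
  · simp [mem_group, pairing]
  · have : ∀ b b' : Fin 2, b' = b ∨ b' = 1 - b := by decide
    simp only [mem_group, pairing, Sum.map_inr, Sum.inr.injEq, Finset.mem_insert,
      Finset.mem_singleton, Prod.mk.injEq, ← and_or_left]
    exact ⟨fun h => ⟨h, this b b'⟩, fun h => h.1⟩

/-- The profile that differs from `s` in the strategy of the partner of `(j, b)`. -/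
def flipPartner (j : Fin l) (b : Fin 2) (s : Profile (Player k l)) : Profile (Player k l) :=
  Function.update s (.inr (j, 1 - b)) (1 - s (.inr (j, 1 - b)))

lemma forall_fiber_inr {j : Fin l} {a : Player k l → Fin 2} {b : Fin 2} :
    (∀ i : {i // pairing k l i = .inr j}, a i = b) ↔
      a (.inr (j, 0)) = b ∧ a (.inr (j, 1)) = b := by
  constructor
  · exact fun h => ⟨h ⟨.inr (j, 0), rfl⟩, h ⟨.inr (j, 1), rfl⟩⟩
  · rintro h ⟨i | ⟨j', b'⟩, hi⟩
    · simp [pairing] at hi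
    · obtain rfl : j' = j := by simpa [pairing] using hi
      fin_cases b'
      exacts [h.1, h.2]

lemma lineFactor_inr (z : Fin k ⊕ Fin l → K) (j : Fin l) (s : Profile (Player k l)) :
    lineFactor (pairing k l) z (.inr j) (fun i => s i) =
      if s (.inr (j, 0)) = 1 ∧ s (.inr (j, 1)) = 1 then 1
      else if s (.inr (j, 0)) = 0 ∧ s (.inr (j, 1)) = 0 then z (.inr j) else -z (.inr j) := by
  simp only [lineFactor, forall_fiber_inr]

lemma lineSegre_flipPartner (z : Fin k ⊕ Fin l → K) (j : Fin l) (b : Fin 2)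
    (s : Profile (Player k l)) (hs : s (.inr (j, b)) = 0) :
    lineSegre (pairing k l) z s + lineSegre (pairing k l) z (flipPartner j b s) = 0 := by
  have h1 : lineFactor (pairing k l) z (.inr j) (fun i => flipPartner j b s i) =
      -lineFactor (pairing k l) z (.inr j) (fun i => s i) := by
    have h2 : ∀ x : Fin 2, x = 0 ∨ x = 1 := by decide
    rw [lineFactor_inr, lineFactor_inr]
    rcases h2 b with rfl | rfl
    · rcases h2 (s (.inr (j, 1))) with h | h <;> simp [flipPartner, hs, h]
    · rcases h2 (s (.inr (j, 0))) with h | h <;> simp [flipPartner, hs, h]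
  rw [lineSegre, lineSegre, ← Finset.mul_prod_erase _ _ (Finset.mem_univ (Sum.inr j)),
    ← Finset.mul_prod_erase _ _ (Finset.mem_univ (Sum.inr j)), h1, neg_mul, ← sub_eq_add_neg,
    sub_eq_zero]
  congr 1
  refine Finset.prod_congr rfl fun r hr => ?_
  congr 1
  ext i
  rw [flipPartner, Function.update_of_ne]
  intro h
  refine Finset.ne_of_mem_erase hr ?_
  rw [← i.2, h]
  rfl

lemma sum_lineFactor_ne_zero {z : Fin k ⊕ Fin l → K} {r : Fin k ⊕ Fin l} (h1 : z r ≠ 1)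
    (h2 : z r ≠ -1) : ∑ a, lineFactor (pairing k l) z r a ≠ 0 := by
  have hne : (fun _ => 0 : Profile {i // pairing k l i = r}) ≠ fun _ => 1 := by
    obtain ⟨i, hi⟩ := pairing_surjective r
    intro h
    exact absurd (congrFun h ⟨i, hi⟩) (by decide)
  have key : ∑ a, lineFactor (pairing k l) z r a =
      1 + (3 - (Fintype.card (Profile {i // pairing k l i = r}) : K)) * z r := by
    have : ∀ a, lineFactor (pairing k l) z r a =
        -z r + (if a = fun _ => 1 then 1 + z r else 0) +
          (if a = fun _ => 0 then 2 * z r else 0) := by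
      intro a
      have e1 : (∀ i, a i = 1) ↔ a = fun _ => 1 := funext_iff.symm
      have e0 : (∀ i, a i = 0) ↔ a = fun _ => 0 := funext_iff.symm
      simp only [lineFactor, e1, e0]
      split_ifs with ha hb hb
      · exact absurd (hb.symm.trans ha) hne
      · ring
      · ring
      · ring
    simp only [this, Finset.sum_add_distrib, Finset.sum_ite_eq', Finset.mem_univ, if_true]
    simp only [Finset.sum_const, Finset.card_univ, nsmul_eq_mul]
    ring
  have hcard : Fintype.card {i // pairing k l i = r} = (group (pairing k l) r).card := by
    rw [Fintype.card_subtype, group]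
  rw [key, Fintype.card_fun, hcard]
  rcases r with q | j
  · rw [group_pairing_inl]
    simp only [Fintype.card_fin, Finset.card_singleton, pow_one]
    intro h
    apply h2
    push_cast at h
    linear_combination h
  · rw [group_pairing_inr j 0, Finset.card_pair (by simp)]
    simp only [Fintype.card_fin]
    intro h
    apply h1
    push_cast at h
    linear_combination -h

/-- The game in which the isolated player `q` has payoff `w q s` if they play `1` in `s`, the
members of a pair have payoff `1` if they both play `1`, and all other payoffs are `0`. -/
def nashGame (w : Fin k → Profile (Player k l) → ℝ) : Game (Player k l)
  | .inl q, s => if s (.inl q) = 1 then w q s else 0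
  | .inr (j, _), s => if s (.inr (j, 0)) = 1 ∧ s (.inr (j, 1)) = 1 then 1 else 0

variable [Algebra ℝ K] (w : Fin k → Profile (Player k l) → ℝ)

lemma det_nashGame_inl (q : Fin k) (p : Profile (Player k l) → K) :
    (spohnMatrix (nashGame w) p (.inl q)).det =
      (∑ s : Profile (Player k l) with s (.inl q) = 0, p s) *
        ∑ s : Profile (Player k l) with s (.inl q) = 1, algebraMap ℝ K (w q s) * p s := by
  rw [det_spohnMatrix_of_eq_zero (by simp +contextual [nashGame])]
  congr 1
  refine Finset.sum_congr rfl fun s hs => ?_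
  simp only [nashGame, (Finset.mem_filter.mp hs).2, if_true]

lemma det_nashGame_inr (j : Fin l) (b : Fin 2) (p : Profile (Player k l) → K) :
    (spohnMatrix (nashGame w) p (.inr (j, b))).det =
      (∑ s : Profile (Player k l) with s (.inr (j, b)) = 0, p s) *
        marginal p (group (pairing k l) (.inr j)) fun _ => 1 := by
  have hb : ∀ s : Profile (Player k l), (s (.inr (j, 0)) = 1 ∧ s (.inr (j, 1)) = 1) ↔
      s (.inr (j, b)) = 1 ∧ ∀ i ∈ group (pairing k l) (.inr j), s i = 1 := by
    intro s
    rw [group_pairing_inr j 0]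
    fin_cases b <;> simp +contextual
  rw [det_spohnMatrix_of_eq_zero]
  · congr 1
    rw [marginal, Finset.sum_filter, Finset.sum_filter]
    refine Finset.sum_congr rfl fun s _ => ?_
    simp only [nashGame, hb]
    have : (∀ i ∈ group (pairing k l) (.inr j), s i = 1) → s (.inr (j, b)) = 1 :=
      fun h => h _ (mem_group.mpr rfl)
    split_ifs <;> simp_all
  · intro s hs
    simp [nashGame, hb, hs]

lemma mem_spohnVariety_lineSegre (z : Fin k ⊕ Fin l → K)
    (hz : ∀ q, ∑ s : Profile (Player k l) with s (.inl q) = 1,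
      algebraMap ℝ K (w q s) * lineSegre (pairing k l) z s = 0)
    (h0 : lineSegre (pairing k l) z ≠ 0) :
    Projectivization.mk K _ h0 ∈ spohnVariety K (nashGame w) := by
  obtain ⟨a, -, ha⟩ := exists_rep_eq_smul _ h0
  intro i
  rw [ha, det_spohnMatrix_smul]
  rcases i with q | ⟨j, b⟩
  · rw [det_nashGame_inl, hz, mul_zero, mul_zero]
  · rw [det_nashGame_inr, Finset.sum_involution fun s _ => flipPartner j b s, zero_mul, mul_zero]
    · intro s hs
      exact lineSegre_flipPartner z j b s (by simpa using hs)
    · intro s _ _ h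
      have h1 := congrFun h (.inr (j, 1 - b))
      have : ∀ x : Fin 2, 1 - x ≠ x := by decide
      simp only [flipPartner, Function.update_self] at h1
      exact this _ h1
    · intro s hs
      have : (Sum.inr (j, b) : Player k l) ≠ .inr (j, 1 - b) := by
        fin_cases b <;> simp
      simpa [flipPartner, Function.update_of_ne this] using hs
    · intro s _
      simp [flipPartner]

lemma notMem_specialHyperplanes_lineSegre {z : Fin k ⊕ Fin l → K}
    (hz : ∀ r, z r ≠ 0 ∧ z r ≠ 1 ∧ z r ≠ -1) (h0 : lineSegre (pairing k l) z ≠ 0) :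
    Projectivization.mk K _ h0 ∉ specialHyperplanes K (Player k l) := by
  obtain ⟨a, ha0, ha⟩ := exists_rep_eq_smul _ h0
  simp only [specialHyperplanes, Set.mem_ofPred_eq, ha, Pi.smul_apply, smul_eq_mul,
    ← Finset.mul_sum, mul_eq_zero, ha0, false_or, not_or, not_exists]
  refine ⟨fun s => ?_, ?_⟩
  · refine Finset.prod_ne_zero_iff.mpr fun r _ => ?_
    simp only [lineFactor]
    split_ifs <;> simp [hz r]
  · rw [show lineSegre (pairing k l) z = segre (pairing k l) (lineFactor _ z) from rfl, sum_segre]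
    exact Finset.prod_ne_zero_iff.mpr fun r _ =>
      sum_lineFactor_ne_zero (hz r).2.1 (hz r).2.2

lemma mem_independenceModel_lineSegre (z : Fin k ⊕ Fin l → K)
    (h0 : lineSegre (pairing k l) z ≠ 0) :
    Projectivization.mk K _ h0 ∈ independenceModel K (cliqueGraph (pairing k l)) := by
  obtain ⟨a, -, ha⟩ := exists_rep_eq_smul _ h0
  intro A B C hAB hAC hBC hsep
  rw [ha]
  exact CondIndep.smul (condIndep_segre _ (lineFactor _ z) hAB hAC hBC hsep) a

lemma linear_equations {Q : ProfileSpace K (Player k l)}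
    (hQ : Q ∈ (spohnVariety K (nashGame w) ∩ independenceModel K (cliqueGraph (pairing k l))) \
      specialHyperplanes K (Player k l)) :
    (∀ q, ∑ s : Profile (Player k l) with s (.inl q) = 1,
      algebraMap ℝ K (w q s) * Q.rep s = 0) ∧
    ∀ j b s, s (.inr (j, b)) = 0 → Q.rep s + Q.rep (flipPartner j b s) = 0 := by
  obtain ⟨⟨hV, hM⟩, hW⟩ := hQ
  constructor
  · intro q
    have h := hV (.inl q)
    rw [det_nashGame_inl] at h
    refine (mul_eq_zero.mp h).resolve_left ?_
    have := marginal_ne_zero hM hW (.inl q) fun _ => 0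
    simpa [marginal, group_pairing_inl] using this
  · intro j b s hs
    have h := hV (.inr (j, b))
    rw [det_nashGame_inr] at h
    exact add_eq_zero_of_marginal_eq_zero hM hW (group_pairing_inr j b) (by fin_cases b <;> simp)
      ((mul_eq_zero.mp h).resolve_right (marginal_ne_zero hM hW _ _)) s hs

/-- The points of the chart are in the image of the parametrization by lines and satisfy the
equations of the isolated players. -/
lemma exists_lineSegre_of_mem_inChart {u : Profile (Player k l) → K}
    (hu : u ∈ inChart (openU K (nashGame w))) :
    ∃ z : Fin k ⊕ Fin l → K, u = lineSegre (pairing k l) z ∧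
      ∀ q, ∑ s : Profile (Player k l) with s (.inl q) = 1,
        algebraMap ℝ K (w q s) * u s = 0 := by
  obtain ⟨h1, h0, hY, σ, hσ, hP, -⟩ := hu
  have hflip : ∀ j b s, s (.inr (j, b)) = 0 → u s + u (flipPartner j b s) = 0 := by
    intro j b s hs
    have h := linear_eq_zero_of_mem_zariskiClosure hY
      (fun t => (if t = s then 1 else 0) + if t = flipPartner j b s then 1 else 0) fun Q hQ => by
        simpa [add_mul, Finset.sum_add_distrib] using (linear_equations w hQ).2 j b s hs
    simpa [add_mul, Finset.sum_add_distrib] using h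
  have hw : ∀ q, ∑ s : Profile (Player k l) with s (.inl q) = 1,
      algebraMap ℝ K (w q s) * u s = 0 := by
    intro q
    have h := linear_eq_zero_of_mem_zariskiClosure hY
      (fun s => if s (.inl q) = 1 then algebraMap ℝ K (w q s) else 0) fun Q hQ => by
        simpa [ite_mul, ← Finset.sum_filter] using (linear_equations w hQ).1 q
    simpa [ite_mul, ← Finset.sum_filter] using h
  obtain ⟨a, ha⟩ := (Projectivization.mk_eq_mk_iff' K _ _ h0 hσ).mp hP
  have hseg := eq_segre_of_eq_smul_segre h1 ha.symm
  refine ⟨fun r => u (extend (pairing k l) r fun _ => 0), ?_, hw⟩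
  conv_lhs => rw [hseg]
  have : (fun r b => u (extend (pairing k l) r b)) =
      lineFactor (pairing k l) fun r => u (extend (pairing k l) r fun _ => 0) := by
    ext r b
    have hb1 : (∀ i, b i = 1) → u (extend (pairing k l) r b) = 1 := by
      intro h
      rw [← h1]
      congr 1
      ext i
      simp [extend, h]
    have hb0 : (∀ i, b i = 0) →
        u (extend (pairing k l) r b) = u (extend (pairing k l) r fun _ => 0) := by
      intro h
      congr 1
      ext i
      simp [extend, h]
    rw [lineFactor]
    split_ifs with e1 e0
    · exact hb1 e1
    · exact hb0 e0
    · rcases r with q | j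
      · exfalso
        have h2 : ∀ x : Fin 2, x = 0 ∨ x = 1 := by decide
        have hb : ∀ i, b i = b ⟨.inl q, rfl⟩ := by
          rintro ⟨i | ⟨j, b⟩, hi⟩
          · obtain rfl : i = q := by simpa [pairing] using hi
            rfl
          · simp [pairing] at hi
        rcases h2 (b ⟨.inl q, rfl⟩) with h | h
        · exact e0 fun i => (hb i).trans h
        · exact e1 fun i => (hb i).trans h
      · set s := extend (pairing k l) (.inr j) b with hs
        have hsb : ∀ i : {i // pairing k l i = .inr j}, b i = s i := by
          intro i; simp [hs, extend, i.2]
        have hmix : ∃ x, s (.inr (j, x)) = 0 ∧ s (.inr (j, 1 - x)) = 1 := by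
          simp only [hsb, forall_fiber_inr] at e0 e1
          have h2 : ∀ x y : Fin 2, ¬ (x = 0 ∧ y = 0) → ¬ (x = 1 ∧ y = 1) →
            (x = 0 ∧ y = 1) ∨ (y = 0 ∧ x = 1) := by decide
          rcases h2 _ _ e0 e1 with h | h
          · exact ⟨0, h⟩
          · exact ⟨1, h⟩
        obtain ⟨x, hx0, hx1⟩ := hmix
        have hf : flipPartner j x s = extend (pairing k l) (.inr j) fun _ => 0 := by
          ext i
          congr 1
          by_cases hi : i ∈ group (pairing k l) (.inr j)
          · rw [group_pairing_inr j x, Finset.mem_insert, Finset.mem_singleton] at hi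
            have hne : (Sum.inr (j, x) : Player k l) ≠ .inr (j, 1 - x) := by
              fin_cases x <;> simp
            rcases hi with rfl | rfl
            · rw [flipPartner, Function.update_of_ne hne, hx0]
              simp [extend, pairing]
            · rw [flipPartner, Function.update_self, hx1]
              simp [extend, pairing]
          · rw [flipPartner, Function.update_of_ne]
            · rw [mem_group] at hi
              simp [hs, extend, hi]
            · rintro rfl
              exact hi (mem_group.mpr rfl)
        have := hflip j x s hx0
        rw [hf] at this
        exact eq_neg_of_add_eq_zero_left this
  rw [this]
  rfl

end Pairing

open MvPolynomial

section Chart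

variable {K : Type*} [Field K] [Algebra ℝ K] {k l n : ℕ}

/-- For all but finitely many `c`, a polynomial function on `S` is determined by its values at the
points with no coordinate in `{-c, 1 - c, -1 - c}`. -/
lemma exists_finite_generic_translation (S : Set (Fin n → K)) :
    ∃ B : Set ℝ, B.Finite ∧ ∀ c ∉ B, ∀ H : MvPolynomial (Fin n) K,
      (∀ x ∈ S, (∀ i, x i + algebraMap ℝ K c ≠ 0 ∧ x i + algebraMap ℝ K c ≠ 1 ∧
        x i + algebraMap ℝ K c ≠ -1) → eval x H = 0) → ∀ x ∈ S, eval x H = 0 := by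
  let I := vanishingIdeal K S
  let φ := Ideal.Quotient.mk I
  let B₀ : Set ℝ := {c | ∃ i, φ (X i + C (algebraMap ℝ K c)) ∉
    nonZeroDivisors (MvPolynomial (Fin n) K ⧸ I)}
  have hB₀ : B₀.Finite := by
    have hsub : B₀ ⊆ ⋃ p ∈ associatedPrimes (MvPolynomial (Fin n) K ⧸ I)
        (MvPolynomial (Fin n) K ⧸ I), ⋃ i : Fin n, {c | φ (X i + C (algebraMap ℝ K c)) ∈ p} := by
      rintro c ⟨i, hi⟩
      have h : φ (X i + C (algebraMap ℝ K c)) ∈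
          ((nonZeroDivisors (MvPolynomial (Fin n) K ⧸ I) : Set _))ᶜ := hi
      rw [← biUnion_associatedPrimes_eq_compl_nonZeroDivisors] at h
      simp only [Set.mem_iUnion] at h ⊢
      obtain ⟨p, hp, hc⟩ := h
      exact ⟨p, hp, i, hc⟩
    refine Set.Finite.subset ?_ hsub
    refine Set.Finite.biUnion (associatedPrimes.finite _ _) fun p hp =>
      Set.finite_iUnion fun i => Set.Subsingleton.finite fun c hc c' hc' => ?_
    by_contra hne
    have h1 := p.sub_mem hc hc'
    rw [← map_sub, add_sub_add_left_eq_sub, ← map_sub, ← map_sub] at h1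
    have hu : IsUnit (φ (C (algebraMap ℝ K (c - c')))) :=
      (((sub_ne_zero.mpr hne).isUnit.map (algebraMap ℝ K)).map C).map φ
    exact hp.isPrime.ne_top (Ideal.eq_top_of_isUnit_mem _ h1 hu)
  refine ⟨B₀ ∪ ((· - 1) ⁻¹' B₀ ∪ (· + 1) ⁻¹' B₀), hB₀.union
    ((hB₀.preimage (sub_left_injective.injOn)).union
      (hB₀.preimage (add_left_injective 1).injOn)), ?_⟩
  intro c hc H hH
  simp only [Set.mem_union, Set.mem_preimage, not_or] at hc
  let q : MvPolynomial (Fin n) K := ∏ i : Fin n, (X i + C (algebraMap ℝ K c)) *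
    ((X i + C (algebraMap ℝ K (c - 1))) * (X i + C (algebraMap ℝ K (c + 1))))
  have hq : φ q ∈ nonZeroDivisors (MvPolynomial (Fin n) K ⧸ I) := by
    simp only [q, map_prod, map_mul φ]
    refine prod_mem fun i _ => mul_mem ?_ (mul_mem ?_ ?_)
    · exact not_not.mp fun h => hc.1 ⟨i, h⟩
    · exact not_not.mp fun h => hc.2.1 ⟨i, h⟩
    · exact not_not.mp fun h => hc.2.2 ⟨i, h⟩
  have hmem : H * q ∈ I := by
    rw [mem_vanishingIdeal_iff]
    intro x hx
    change eval x (H * q) = 0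
    rw [map_mul]
    by_cases h : ∀ i, x i + algebraMap ℝ K c ≠ 0 ∧ x i + algebraMap ℝ K c ≠ 1 ∧
        x i + algebraMap ℝ K c ≠ -1
    · rw [hH x hx h, zero_mul]
    · push Not at h
      obtain ⟨i, hi⟩ := h
      have : eval x q = 0 := by
        simp only [q, map_prod]
        refine Finset.prod_eq_zero (Finset.mem_univ i) ?_
        simp only [map_mul, map_add, map_sub, eval_X, eval_C, map_one]
        by_cases h0 : x i + algebraMap ℝ K c = 0
        · rw [h0, zero_mul]
        by_cases h1 : x i + algebraMap ℝ K c = 1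
        · linear_combination (x i + algebraMap ℝ K c) * (x i + algebraMap ℝ K c + 1) * h1
        · linear_combination
            (x i + algebraMap ℝ K c) * (x i + algebraMap ℝ K c - 1) * hi h0 h1
      rw [this, mul_zero]
  have hI : H ∈ I := by
    rw [← Ideal.Quotient.eq_zero_iff_mem] at hmem ⊢
    rw [map_mul] at hmem
    exact (mul_right_mem_nonZeroDivisors_eq_zero_iff hq).mp hmem
  intro x hx
  exact (mem_vanishingIdeal_iff.mp hI) x hx

/-- The parametrization of the open set by the affine space whose `i`-th coordinate, up to the
translation by `c`, is the parameter of each group `r` with `ρ r = i`. -/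
noncomputable def chartMap (ρ : Fin k ⊕ Fin l → Fin n) (c : ℝ) :
    Profile (Player k l) → MvPolynomial (Fin n) ℝ :=
  lineSegre (pairing k l) fun r => X (ρ r) + C c

lemma polyMap_chartMap (ρ : Fin k ⊕ Fin l → Fin n) (c : ℝ) (x : Fin n → K) :
    polyMap K (chartMap ρ c) x =
      lineSegre (pairing k l) fun r => x (ρ r) + algebraMap ℝ K c := by
  ext s
  rw [polyMap, chartMap, map_lineSegre]
  simp

lemma inChart_openU_eq (w : Fin k → Profile (Player k l) → ℝ) (ρ : Fin k ⊕ Fin l → Fin n) (c : ℝ)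
    (S : Set (Fin n → K))
    (hw : ∀ z : Fin k ⊕ Fin l → K, (∀ q, ∑ s : Profile (Player k l) with s (.inl q) = 1,
      algebraMap ℝ K (w q s) * lineSegre (pairing k l) z s = 0) ↔
        ∃ x ∈ S, z = fun r => x (ρ r) + algebraMap ℝ K c)
    (hc : ∀ H : MvPolynomial (Fin n) K,
      (∀ x ∈ S, (∀ i, x i + algebraMap ℝ K c ≠ 0 ∧ x i + algebraMap ℝ K c ≠ 1 ∧
        x i + algebraMap ℝ K c ≠ -1) → eval x H = 0) → ∀ x ∈ S, eval x H = 0) :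
    inChart (openU K (nashGame w)) = polyMap K (chartMap ρ c) '' S := by
  ext u
  constructor
  · intro hu
    obtain ⟨z, rfl, hz⟩ := exists_lineSegre_of_mem_inChart w hu
    obtain ⟨x, hx, rfl⟩ := (hw z).mp hz
    exact ⟨x, hx, polyMap_chartMap ρ c x⟩
  · rintro ⟨x, hx, rfl⟩
    have hone : ∀ x : Fin n → K, polyMap K (chartMap ρ c) x (fun _ => 1) = 1 := fun x => by
      rw [polyMap_chartMap, lineSegre_one]
    have hne : ∀ x : Fin n → K, polyMap K (chartMap ρ c) x ≠ 0 := fun x h => by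
      simpa [h] using hone x
    refine ⟨hone x, hne x, ?_, lineFactor (pairing k l) fun r => x (ρ r) + algebraMap ℝ K c, ?_, ?_,
      fun r => ?_⟩
    · refine (mem_zariskiClosure_mk _ _).mpr fun H d hH hT => ?_
      let H' : MvPolynomial (Fin n) K :=
        aeval (fun s => MvPolynomial.map (algebraMap ℝ K) (chartMap ρ c s)) H
      have hH' : ∀ x : Fin n → K, eval x H' = eval (polyMap K (chartMap ρ c) x) H := by
        intro x
        change eval x (aeval _ H) = _
        rw [aeval_def, algebraMap_eq, eval_eval₂]
        simp only [eval_map]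
        change eval₂ ((eval x).comp C) _ H = eval₂ (RingHom.id K) _ H
        congr 1
        ext a
        simp
      rw [← hH']
      refine hc H' (fun y hy hgen => ?_) x hx
      rw [hH']
      obtain ⟨a, ha0, ha⟩ := exists_rep_eq_smul _ (hne y)
      have h := hT (Projectivization.mk K _ (hne y)) (by
        have hy0 := hne y
        simp only [polyMap_chartMap] at hy0 ⊢
        exact ⟨⟨mem_spohnVariety_lineSegre w _ ((hw _).mpr ⟨y, hy, rfl⟩) hy0,
          mem_independenceModel_lineSegre _ hy0⟩,
          notMem_specialHyperplanes_lineSegre (fun r => hgen (ρ r)) hy0⟩)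
      rw [ha, eval_smul_of_isHomogeneous hH] at h
      exact (mul_eq_zero.mp h).resolve_left (pow_ne_zero _ ha0)
    · have := hne x
      rwa [polyMap_chartMap] at this
    · simp only [polyMap_chartMap]
      rfl
    · rw [lineFactor_one]
      exact one_ne_zero

/-- The inverse of `chartMap`, if `τ i` is a group with `ρ (τ i) = i`. -/
noncomputable def chartInv (τ : Fin n → Fin k ⊕ Fin l) (c : ℝ) :
    Fin n → MvPolynomial (Profile (Player k l)) ℝ :=
  fun i => X (groupProfile (pairing k l) {τ i}) - C c

lemma chartInv_chartMap {ρ : Fin k ⊕ Fin l → Fin n} {τ : Fin n → Fin k ⊕ Fin l}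
    (h : ∀ i, ρ (τ i) = i) (c : ℝ) (x : Fin n → K) :
    polyMap K (chartInv τ c) (polyMap K (chartMap ρ c) x) = x := by
  ext i
  rw [polyMap_chartMap]
  simp [polyMap, chartInv, lineSegre_groupProfile pairing_surjective, h]

lemma inversePolyMaps_image {υ τ : Type*} (f : υ → MvPolynomial τ ℝ) (g : τ → MvPolynomial υ ℝ)
    (h : ∀ x : τ → K, polyMap K g (polyMap K f x) = x) (A : Set (τ → K)) :
    InversePolyMaps f g A (polyMap K f '' A) := by
  refine ⟨Set.mapsTo_image _ _, ?_, fun x _ => h x, ?_⟩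
  · rintro _ ⟨x, hx, rfl⟩
    rwa [h]
  · rintro _ ⟨x, _, rfl⟩
    rw [h]

end Chart

section Avoiding

variable {V : Type*}

/-- The multi-affine real polynomials that do not involve the variable `v`. -/
noncomputable def avoiding (v : V) : Submodule ℝ (MvPolynomial V ℝ) :=
  Submodule.span ℝ {P | ∃ T : Finset V, v ∉ T ∧ P = ∏ q ∈ T, X q}

lemma prod_X_mem_avoiding {v : V} {T : Finset V} (h : v ∉ T) :
    (∏ q ∈ T, X q : MvPolynomial V ℝ) ∈ avoiding v :=
  Submodule.subset_span ⟨T, h, rfl⟩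

lemma X_mem_avoiding {v q : V} (h : v ≠ q) : (X q : MvPolynomial V ℝ) ∈ avoiding v := by
  simpa using prod_X_mem_avoiding (v := v) (T := {q}) (by simpa using h)

lemma C_mem_avoiding (v : V) (a : ℝ) : (C a : MvPolynomial V ℝ) ∈ avoiding v := by
  have := (avoiding v).smul_mem a (prod_X_mem_avoiding (v := v) (T := ∅) (by simp))
  simpa [smul_eq_C_mul] using this

/-- The equation of an isolated player can be any multi-affine polynomial that does not involve
the parameter of this player. -/
lemma exists_payoff {k l : ℕ} (e : Fin k ⊕ Fin l ≃ V) (c : ℝ) (q : Fin k)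
    {E : MvPolynomial V ℝ} (hE : E ∈ avoiding (e (.inl q))) :
    ∃ w : Profile (Player k l) → ℝ, ∀ (K : Type) [Field K] [Algebra ℝ K]
      (z : Fin k ⊕ Fin l → K), ∑ s : Profile (Player k l) with s (.inl q) = 1,
        algebraMap ℝ K (w s) * lineSegre (pairing k l) z s =
          aeval (fun v => z (e.symm v) - algebraMap ℝ K c) E := by
  classical
  let φ : MvPolynomial V ℝ →ₐ[ℝ] MvPolynomial (Fin k ⊕ Fin l) ℝ :=
    aeval fun v => X (e.symm v) - C c
  let S : Set (Profile (Player k l)) := {s | s (.inl q) = 1}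
  have hspan : φ E ∈ Submodule.span ℝ (lineSegre (pairing k l) X '' S) := by
    have hle : avoiding (e (.inl q)) ≤
        (Submodule.span ℝ (lineSegre (pairing k l) X '' S)).comap φ.toLinearMap := by
      refine Submodule.span_le.mpr ?_
      rintro _ ⟨T, hT, rfl⟩
      have h := prod_sub_mem_span_lineSegre (R := MvPolynomial (Fin k ⊕ Fin l) ℝ)
        (pairing_surjective (k := k) (l := l)) X c (.inl q) (T := T.map e.symm.toEmbedding) (by
          intro h
          obtain ⟨v, hv, hvq⟩ := Finset.mem_map.mp h
          apply hT
          have : v = e (.inl q) := by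
            rw [← Equiv.symm_apply_eq]; exact hvq
          rwa [← this])
      rw [Finset.prod_map] at h
      simpa [φ, map_prod] using h
    exact hle hE
  obtain ⟨a, ha⟩ := (Fintype.mem_span_image_iff_exists_fun ℝ).mp hspan
  refine ⟨fun s => if h : s ∈ S then a ⟨s, h⟩ else 0, fun K _ _ z => ?_⟩
  have h1 : aeval z (φ E) = aeval (fun v => z (e.symm v) - algebraMap ℝ K c) E := by
    rw [← AlgHom.comp_apply]
    congr 1
    ext v
    simp [φ]
  rw [← h1, ← ha, map_sum, Finset.sum_subtype (p := fun s => s ∈ S) (F := Fintype.ofFinite _) _ (by simp [S])]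
  refine Finset.sum_congr (by ext; simp) fun s _ => ?_
  beta_reduce
  rw [dif_pos s.2, map_smul, map_lineSegre, Algebra.smul_def]
  simp

end Avoiding

variable {n m l : ℕ}

/-- The variables after splitting: `δ i` copies of the `i`-th variable, and the original ones. -/
abbrev SplitVar (δ : Fin n → ℕ) := (Σ i, Fin (δ i)) ⊕ Fin n

/-- The original variable. -/
def SplitVar.base {δ : Fin n → ℕ} : SplitVar δ → Fin n :=
  Sum.elim Sigma.fst id

/-- The multi-affine polynomial obtained from `F` by replacing the powers of the `i`-th variable
with products of copies of it. -/
noncomputable def splitPoly (δ : Fin n → ℕ) (F : MvPolynomial (Fin n) ℝ) :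
    MvPolynomial (SplitVar δ) ℝ :=
  ∑ d ∈ F.support, coeff d F •
    ∏ q ∈ (Finset.univ.filter fun p : Σ i, Fin (δ i) => p.2.val < d p.1).map
      Function.Embedding.inl, X q

lemma splitPoly_mem_avoiding (δ : Fin n → ℕ) (F : MvPolynomial (Fin n) ℝ) (i : Fin n) :
    splitPoly δ F ∈ avoiding (.inr i) :=
  Submodule.sum_mem _ fun _ _ => Submodule.smul_mem _ _ (prod_X_mem_avoiding (by simp))

lemma aeval_splitPoly {R : Type*} [CommRing R] [Algebra ℝ R] {δ : Fin n → ℕ}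
    {F : MvPolynomial (Fin n) ℝ} (hF : ∀ i, F.degreeOf i ≤ δ i) {y : SplitVar δ → R}
    {x : Fin n → R} (h : ∀ p, y (.inl p) = x p.1) : aeval y (splitPoly δ F) = aeval x F := by
  rw [splitPoly, map_sum, aeval_def x, eval₂_eq']
  refine Finset.sum_congr rfl fun d hd => ?_
  rw [map_smul, Algebra.smul_def, map_prod, Finset.prod_map]
  congr 1
  simp only [Function.Embedding.inl_apply, aeval_X, h]
  rw [Finset.prod_filter, Fintype.prod_sigma]
  refine Finset.prod_congr rfl fun i _ => ?_
  dsimp only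
  rw [← Finset.prod_filter, Finset.prod_const, Fin.card_filter_val_lt,
    min_eq_right ((degreeOf_le_iff.mp (hF i)) d hd)]

lemma eq_C_mul_X_add_C {F : MvPolynomial (Fin n) ℝ} {i : Fin n}
    (hF : ∀ d ∈ F.support, d = 0 ∨ d = Finsupp.single i 1) :
    F = C (coeff (Finsupp.single i 1) F) * X i + C (coeff 0 F) := by
  ext d
  have h10 : Finsupp.single i 1 ≠ (0 : Fin n →₀ ℕ) := by simp
  rw [coeff_add, coeff_C_mul, coeff_X, coeff_C]
  by_cases h0 : d = 0
  · subst h0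
    simp
  by_cases h1 : d = Finsupp.single i 1
  · subst h1
    rw [if_pos rfl, if_neg h10.symm]
    ring
  · rw [if_neg (Ne.symm h1), if_neg (Ne.symm h0), mul_zero, add_zero, ← notMem_support_iff]
    exact fun h => (hF d h).elim h0 h1

lemma exists_perm_forall_ne {D : Type*} [Fintype D] (h : Fintype.card D ≠ 1) :
    ∃ θ : Equiv.Perm D, ∀ p, θ p ≠ p := by
  let f := Fintype.equivFin D
  refine ⟨(f.trans (finRotate _)).trans f.symm, fun p hp => ?_⟩
  simp only [Equiv.trans_apply, Equiv.symm_apply_eq] at hp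
  have hpos : 0 < Fintype.card D := Fintype.card_pos_iff.mpr ⟨p⟩
  obtain ⟨N, hN⟩ : ∃ N, Fintype.card D = N + 2 := ⟨Fintype.card D - 2, by omega⟩
  generalize f p = a at hp
  revert a
  rw [hN]
  intro a ha
  rw [finRotate_apply] at ha
  simp at ha

/-- The copies can be identified with the original variables by equations of which each avoids
one copy. -/
lemma exists_copy_equations (G : Fin m → MvPolynomial (Fin n) ℝ) (δ : Fin n → ℕ)
    (hδ : ∀ i, δ i = Finset.univ.sup fun j => (G j).degreeOf i) :
    ∃ E : (Σ i, Fin (δ i)) → MvPolynomial (SplitVar δ) ℝ,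
      (∀ p, E p ∈ avoiding (.inl p)) ∧
      ∀ (K : Type) [Field K] [Algebra ℝ K] (y : SplitVar δ → K),
        (∀ j, aeval y (splitPoly δ (G j)) = 0) →
          ((∀ p, aeval y (E p) = 0) ↔ ∀ p, y (.inl p) = y (.inr p.1)) := by
  have hle : ∀ j i, (G j).degreeOf i ≤ δ i := fun j i => by
    rw [hδ]
    exact Finset.le_sup (f := fun j => (G j).degreeOf i) (Finset.mem_univ j)
  by_cases hD : Fintype.card (Σ i, Fin (δ i)) = 1
  · obtain ⟨⟨i, t⟩, hp⟩ := Fintype.card_eq_one_iff.mp hD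
    have hi : 0 < δ i := t.pos
    have hδ1 : ∀ i', i' ≠ i → δ i' = 0 := by
      intro i' hi'
      by_contra h
      exact hi' (congrArg Sigma.fst (hp ⟨i', ⟨0, Nat.pos_of_ne_zero h⟩⟩))
    have hδ2 : δ i ≤ 1 := by
      by_contra h
      have h01 := (hp ⟨i, ⟨0, hi⟩⟩).trans (hp ⟨i, ⟨1, by omega⟩⟩).symm
      simp at h01
    have h' := hi
    rw [hδ, Finset.lt_sup_iff] at h'
    obtain ⟨j, -, hj⟩ := h'
    have hsupp : ∀ d ∈ (G j).support, d = 0 ∨ d = Finsupp.single i 1 := by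
      intro d hd
      have hd' : ∀ i', d i' ≤ δ i' := fun i' => degreeOf_le_iff.mp (hle j i') d hd
      have h0 : ∀ i', i' ≠ i → d i' = 0 := fun i' hi' => by
        have := hd' i'; rw [hδ1 i' hi'] at this; omega
      have h1 : d i = 0 ∨ d i = 1 := by have := hd' i; omega
      refine h1.imp (fun h => ?_) fun h => ?_
      · ext i'
        by_cases hi' : i' = i
        · rw [hi', h]; rfl
        · rw [h0 i' hi']; rfl
      · ext i'
        by_cases hi' : i' = i
        · rw [hi', h, Finsupp.single_eq_same]
        · rw [h0 i' hi', Finsupp.single_eq_of_ne hi']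
    have hα : coeff (Finsupp.single i 1) (G j) ≠ 0 := by
      intro h
      refine absurd (degreeOf_le_iff.mpr fun d hd => ?_) (not_le.mpr hj)
      rcases hsupp d hd with rfl | rfl
      · simp
      · exact absurd h (mem_support_iff.mp hd)
    have hG := eq_C_mul_X_add_C hsupp
    set α := coeff (Finsupp.single i 1) (G j)
    set β := coeff 0 (G j)
    refine ⟨fun _ => C α * X (.inr i) + C β, fun p => ?_, fun K _ _ y hy => ?_⟩
    · rw [← smul_eq_C_mul]
      exact add_mem (Submodule.smul_mem _ _ (X_mem_avoiding (by simp))) (C_mem_avoiding _ _)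
    · have h1 := hy j
      rw [aeval_splitPoly (hle j) (x := fun _ => y (.inl ⟨i, t⟩)) (fun p => by rw [hp p]), hG] at h1
      simp only [map_add, map_mul, aeval_C, aeval_X] at h1 ⊢
      have hα' : algebraMap ℝ K α ≠ 0 := by simpa using hα
      constructor
      · intro h p
        rw [hp p]
        exact mul_left_cancel₀ hα' (by linear_combination h1 - h p)
      · intro h _
        rw [← h ⟨i, t⟩, h1]
  · obtain ⟨θ, hθ⟩ := exists_perm_forall_ne hD
    refine ⟨fun p => X (.inl (θ p)) - X (.inr (θ p).1), fun p => ?_, fun K _ _ y _ => ?_⟩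
    · exact sub_mem (X_mem_avoiding fun h => hθ p (Sum.inl_injective h).symm)
        (X_mem_avoiding (by simp))
    · simp only [map_sub, aeval_X, sub_eq_zero]
      exact θ.forall_congr_right (q := fun p => y (.inl p) = y (.inr p.1))

lemma exists_group_equiv (D : Type*) [Fintype D] (h : l ≤ n) :
    ∃ e : Fin (Fintype.card D + (n - l)) ⊕ Fin l ≃ D ⊕ Fin n,
      (∀ p, ∃ q, e (.inl q) = .inl p) ∧ ∀ i : Fin n, i.val < n - l → ∃ q, e (.inl q) = .inr i := by
  let e₁ : Fin (Fintype.card D + (n - l)) ≃ D ⊕ Fin (n - l) :=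
    finSumFinEquiv.symm.trans (Equiv.sumCongr (Fintype.equivFin D).symm (Equiv.refl _))
  let e₂ : Fin (n - l) ⊕ Fin l ≃ Fin n :=
    finSumFinEquiv.trans (finCongr (Nat.sub_add_cancel h))
  let e := ((Equiv.sumCongr e₁ (Equiv.refl (Fin l))).trans (Equiv.sumAssoc _ _ _)).trans
    (Equiv.sumCongr (Equiv.refl D) e₂)
  refine ⟨e, fun p => ⟨e₁.symm (.inl p), ?_⟩, fun i hi => ⟨e₁.symm (.inr ⟨i, hi⟩), ?_⟩⟩
  · simp [e]
  · simp only [e, Equiv.trans_apply, Equiv.sumCongr_apply, Sum.map_inl, Equiv.apply_symm_apply,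
      Equiv.sumAssoc_apply_inl_inr, Sum.map_inr, Sum.inr.injEq]
    ext
    simp [e₂]

/-- Every real affine variety has the equations of the isolated players of a game. -/
lemma exists_nashGame_equations (G : Fin m → MvPolynomial (Fin n) ℝ) (δ : Fin n → ℕ)
    (hδ : ∀ i, δ i = Finset.univ.sup fun j => (G j).degreeOf i) (hml : m + l ≤ n) (c : ℝ) :
    ∃ (w : Fin (Fintype.card (Σ i, Fin (δ i)) + (n - l)) →
        Profile (Player (Fintype.card (Σ i, Fin (δ i)) + (n - l)) l) → ℝ)
      (ρ : Fin (Fintype.card (Σ i, Fin (δ i)) + (n - l)) ⊕ Fin l → Fin n)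
      (τ : Fin n → Fin (Fintype.card (Σ i, Fin (δ i)) + (n - l)) ⊕ Fin l),
      (∀ i, ρ (τ i) = i) ∧ ∀ (K : Type) [Field K] [Algebra ℝ K]
        (z : Fin (Fintype.card (Σ i, Fin (δ i)) + (n - l)) ⊕ Fin l → K),
        (∀ q, ∑ s : Profile (Player _ l) with s (.inl q) = 1,
          algebraMap ℝ K (w q s) * lineSegre (pairing _ l) z s = 0) ↔
            ∃ x ∈ zeroSet K G, z = fun r => x (ρ r) + algebraMap ℝ K c := by
  obtain ⟨E, hE, hcopy⟩ := exists_copy_equations G δ hδ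
  obtain ⟨e, he₁, he₂⟩ := exists_group_equiv (n := n) (l := l) (Σ i, Fin (δ i)) (by omega)
  have hle : ∀ j i, (G j).degreeOf i ≤ δ i := fun j i => by
    rw [hδ]
    exact Finset.le_sup (f := fun j => (G j).degreeOf i) (Finset.mem_univ j)
  let F : SplitVar δ → MvPolynomial (SplitVar δ) ℝ :=
    Sum.elim E fun i => if h : i.val < m then splitPoly δ (G ⟨i, h⟩) else 0
  have hF : ∀ v, F v ∈ avoiding v := by
    rintro (p | i)
    · exact hE p
    · simp only [F, Sum.elim_inr]
      split_ifs
      · exact splitPoly_mem_avoiding _ _ _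
      · exact zero_mem _
  choose w hw using fun q => exists_payoff e c q (hF (e (.inl q)))
  refine ⟨w, fun r => SplitVar.base (e r), fun i => e.symm (.inr i), fun i => by
    simp [SplitVar.base], fun K _ _ z => ?_⟩
  simp only [hw]
  set y : SplitVar δ → K := fun v => z (e.symm v) - algebraMap ℝ K c with hy
  have hF' : (∀ q, aeval y (F (e (.inl q))) = 0) ↔
      (∀ p, aeval y (E p) = 0) ∧ ∀ j, aeval y (splitPoly δ (G j)) = 0 := by
    constructor
    · refine fun h => ⟨fun p => ?_, fun j => ?_⟩
      · obtain ⟨q, hq⟩ := he₁ p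
        simpa [hq, F] using h q
      · obtain ⟨q, hq⟩ := he₂ ⟨j, by omega⟩ (by dsimp only; omega)
        simpa [hq, F] using h q
    · rintro ⟨h₁, h₂⟩ q
      rcases e (.inl q) with p | i
      · exact h₁ p
      · simp only [F, Sum.elim_inr]
        split_ifs
        · exact h₂ _
        · exact map_zero _
  rw [hF']
  constructor
  · rintro ⟨h₁, h₂⟩
    have h := (hcopy K y h₂).mp h₁
    refine ⟨fun i => y (.inr i), fun j => ?_, ?_⟩
    · rw [← h₂ j, aeval_splitPoly (hle j) (x := fun i => y (.inr i)) h]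
    · ext r
      have hbase : ∀ v, y (.inr (SplitVar.base v)) = y v := by
        rintro (p | i)
        · exact (h p).symm
        · rfl
      beta_reduce
      rw [hbase]
      simp [hy]
  · rintro ⟨x, hx, hz⟩
    have hyx : ∀ v, y v = x (SplitVar.base v) := by
      intro v
      simp [hy, hz]
    have h₂ : ∀ j, aeval y (splitPoly δ (G j)) = 0 := fun j => by
      rw [aeval_splitPoly (hle j) (x := x) fun p => hyx _]
      exact hx j
    exact ⟨(hcopy K y h₂).mpr fun p => (hyx (.inl p)).trans (hyx (.inr p.1)).symm, h₂⟩

end NashCI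

theorem theorem5p4 (n m l : ℕ) (hml : m + l ≤ n)
    (G : Fin m → MvPolynomial (Fin n) ℝ) :
    ∃ k : ℕ,
      Fintype.card (NashCI.Player k l) =
        (∑ i : Fin n, Finset.univ.sup fun j : Fin m => (G j).degreeOf i) + n + l ∧
      ∃ (X : NashCI.Game (NashCI.Player k l))
        (f : NashCI.Profile (NashCI.Player k l) → MvPolynomial (Fin n) ℝ)
        (g : Fin n → MvPolynomial (NashCI.Profile (NashCI.Player k l)) ℝ),
        NashCI.InversePolyMaps f g (NashCI.zeroSet ℝ G) (NashCI.inChart (NashCI.openU ℝ X)) ∧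
        NashCI.InversePolyMaps f g (NashCI.zeroSet ℂ G) (NashCI.inChart (NashCI.openU ℂ X)) := by
  obtain ⟨Bℝ, hBℝ, hℝ⟩ := NashCI.exists_finite_generic_translation (NashCI.zeroSet ℝ G)
  obtain ⟨Bℂ, hBℂ, hℂ⟩ := NashCI.exists_finite_generic_translation (NashCI.zeroSet ℂ G)
  obtain ⟨c, hc⟩ := (hBℝ.union hBℂ).exists_notMem
  rw [Set.mem_union, not_or] at hc
  obtain ⟨w, ρ, τ, hρτ, hw⟩ := NashCI.exists_nashGame_equations G
    (fun i => Finset.univ.sup fun j => (G j).degreeOf i) (fun _ => rfl) hml c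
  refine ⟨_, ?_, NashCI.nashGame w, NashCI.chartMap ρ c, NashCI.chartInv τ c, ?_, ?_⟩
  · simp only [Fintype.card_sum, Fintype.card_prod, Fintype.card_fin, Fintype.card_sigma]
    omega
  · rw [NashCI.inChart_openU_eq w ρ c _ (hw ℝ) (hℝ c hc.1)]
    exact NashCI.inversePolyMaps_image _ _ (NashCI.chartInv_chartMap hρτ c) _
  · rw [NashCI.inChart_openU_eq w ρ c _ (hw ℂ) (hℂ c hc.2)]
    exact NashCI.inversePolyMaps_image _ _ (NashCI.chartInv_chartMap hρτ c) _
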